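/- Let $q$ be a power of $2$, let $m\ge 2$ be even, and let $\mathrm{Tr}$ be the trace from $\mathbb F_{q^m}$ to $\mathbb F_q$. Let $f:\mathbb F_{q^m}\to\mathbb F_q$ be a quadratic form over $\mathbb F_q$ that is non-degenerate, i.e. $\{x : f(x+y)=f(y)\text{ for all }y\}=\{0\}$, and equivalent to Type I, i.e. in the coordinates of some $\mathbb F_q$-basis of $\mathbb F_{q^m}$ it is $x_1x_2+x_3x_4+\cdots+x_{t-1}x_t$, where $t$ is its rank (so $t=m$). Let $a\in\mathbb F_q\setminus\{0\}$, let $D_f=\{x\in\mathbb F_{q^m} : f(x)=a\}$, and let $\mathcal C_{D_f}=\{(\mathrm{Tr}(xd))_{d\in D_f} : x\in\mathbb F_{q^m}\}$, a linear code over $\mathbb F_q$. Write $d_r$ for its $r$-th generalized Hamming weight: the least number of coordinates in the support of an $r$-dimensional subspace $H$ of $\mathcal C_{D_f}$, where the support of $H$ is the set of coordinates at which some word of $H$ is non-zero. Then $\mathcal C_{D_f}$ has length $n=|D_f|=q^{m-1}-q^{(m-2)/2}$. If moreover $(q,m)\neq(2,2)$, then $\mathcal C_{D_f}$ has dimension $m$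 and its weight hierarchy is $$d_r=\begin{cases} n-q^{m-2}, & r=1,\\ n-q^{m-r-1}-q^{(m-4)/2}, & 2\le r\le m/2,\\ n-q^{m-r-1}-q^{m-r-2}, & m/2<r<m-1,\\ n-1, & r=m-1,\\ n, & r=m.\end{cases}$$ (For $m=2$ the first and fourth cases coincide and agree.) -/

import Mathlib

/-- The code with defining set `D ⊆ K`: all words `(Tr (x * d))_{d ∈ D}` for `x ∈ K`,
where `Tr` is the trace from `K` to `F` and the coordinates are indexed by `D`. -/
noncomputable def definingSetCode (F : Type*) {K : Type*} [Field F] [Field K] [Algebra F K]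
    (D : Set K) : Submodule F (D → F) :=
  LinearMap.range
    (LinearMap.pi fun d : D => (Algebra.trace F K).comp (LinearMap.mulRight F (d : K)))

/-- The support of a space of words: the coordinates at which some word of the space
does not vanish. -/
def codeSupport {F ι : Type*} [Field F] (H : Submodule F (ι → F)) : Set ι :=
  {i | ∃ c ∈ H, c i ≠ 0}

/-- The `r`-th generalized Hamming weight of `C`: the least support size of an
`r`-dimensional subspace of `C` (meaningful for `r` at most the dimension of `C`). -/
noncomputable def generalizedHammingWeight {F ι : Type*} [Field F] (C : Submodule F (ι → F))
    (r : ℕ) : ℕ :=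
  sInf {w : ℕ | ∃ H : Submodule F (ι → F),
    H ≤ C ∧ Module.finrank F H = r ∧ (codeSupport H).ncard = w}

/-- A quadratic form is equivalent to Type I if, in the coordinates of a suitable basis, it is
`x₁ x₂ + x₃ x₄ + ⋯ + x_{2k-1} x_{2k}` for some `k` (its rank is then `2k`); the coordinates
are numbered from zero here. -/
def IsEquivalentToTypeI {F V : Type*} [Field F] [AddCommGroup V] [Module F V]
    (f : QuadraticForm F V) : Prop :=
  ∃ (k : ℕ) (hk : 2 * k ≤ Module.finrank F V) (b : Module.Basis (Fin (Module.finrank F V)) F V),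
    ∀ x : V, f x = ∑ i : Fin k,
      b.repr x ⟨2 * (i : ℕ), by omega⟩ * b.repr x ⟨2 * (i : ℕ) + 1, by omega⟩

/-! The support of the words coming from a subspace of `K` is the complement in `D` of its
trace-orthogonal, so `d_r` equals `n` minus the largest size of `D ∩ W` over subspaces `W` of
dimension `m - r`.

To count, fix a nontrivial additive character `χ` of `F` with values ±1 and let `S(W)` be the sum of
`χ (f x)` over `W`. Every scalar is a square, so `S(W)` does not change when `f` is scaled, and for
`a ≠ 0` the count on `W` is `(q^dim W - S(W)) / q` (`card_mul_levelCount`). It remains to make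
`-S(W)` as large as possible.

Poisson summation (`card_mul_quadraticCharSum_inf_orthogonal`) is used twice. With `U = W` it gives
`S(W)^2 = q^dim W * S(R)`, where `R` is the radical of the polar form on `W`; `R` is `W` or has
codimension at least two, whence `-S(W) ≤ q^(dim W - 1)`. With `W` the whole space, of dimension
`2k`, it gives `q^dim U * S(U^⊥) = q^k * S(U)`, which transfers bounds and examples from dimension
`s` to `2k - s`. Equality for `2 ≤ s ≤ k` comes from an anisotropic plane plus a totally singular
space; lines spanned by nonsingular vectors have `S = 0` and settle `s = 1` and, by duality,
hyperplanes. -/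

open Finset in
open Classical in
/-- The sum of the values of an additive character over the values of a quadratic form
on a subspace. -/
noncomputable def quadraticCharSum {F V : Type*} [Field F] [AddCommGroup V] [Module F V]
    [Fintype V] (χ : AddChar F ℤ) (f : QuadraticForm F V) (W : Submodule F V) : ℤ :=
  ∑ x with x ∈ W, χ (f x)

open Finset in
open Classical in
/-- The number of vectors of a subspace at which a quadratic form takes the value `a`. -/
noncomputable def levelCount {F V : Type*} [Field F] [AddCommGroup V] [Module F V]
    [Fintype V] (f : QuadraticForm F V) (a : F) (W : Submodule F V) : ℕ :=
  #{x | x ∈ W ∧ f x = a}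

/-! ### Characters and polar forms in characteristic two -/

section CharTwo

variable {F V : Type*} [Field F] [CharP F 2] [AddCommGroup V] [Module F V]

theorem addChar_int_le_one (χ : AddChar F ℤ) (x : F) : χ x ≤ 1 := by
  have : χ x * χ x = 1 := by
    rw [← AddChar.map_add_eq_mul, CharTwo.add_self_eq_zero, AddChar.map_zero_eq_one]
  nlinarith

/-- Compose the sign character of `ZMod 2` with a linear functional sending 1 to 1. -/
theorem exists_addChar_int_ne_one (F : Type*) [Field F] [CharP F 2] :
    ∃ χ : AddChar F ℤ, χ ≠ 1 := by
  let _ : Algebra (ZMod 2) F := ZMod.algebra F 2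
  obtain ⟨l, hl⟩ := Module.Projective.exists_dual_eq_one (ZMod 2) (one_ne_zero (α := F))
  refine ⟨(AddChar.zmodChar 2 (ζ := (-1 : ℤ)) (by norm_num)).compAddMonoidHom l.toAddMonoidHom,
    AddChar.ne_one_iff.2 ⟨1, ?_⟩⟩
  simp [AddChar.zmodChar_apply, hl, ZMod.val_one]

theorem map_add_charTwo (f : QuadraticForm F V) (x y : V) :
    f x + f.polarBilin y x = f (y + x) + f y := by
  rw [QuadraticMap.map_add f y x, QuadraticMap.polarBilin_apply_apply]
  linear_combination (- f y) * CharTwo.two_eq_zero (R := F)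

theorem polarBilin_self_charTwo (f : QuadraticForm F V) (x : V) : f.polarBilin x x = 0 := by
  rw [QuadraticMap.polarBilin_apply_apply, QuadraticMap.polar_self, two_smul,
    CharTwo.add_self_eq_zero]

/-- The radical of an alternating form does not have codimension one. -/
theorem finrank_inf_orthogonal_add_two_le [FiniteDimensional F V]
    (f : QuadraticForm F V) {W : Submodule F V}
    (hW : ¬ W ≤ LinearMap.BilinForm.orthogonal f.polarBilin W) :
    Module.finrank F ↥(W ⊓ LinearMap.BilinForm.orthogonal f.polarBilin W) + 2 ≤
      Module.finrank F W := by
  set R := W ⊓ LinearMap.BilinForm.orthogonal f.polarBilin W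
  have hRW : R ≤ W := inf_le_left
  obtain ⟨w, hw, hwR⟩ := Set.not_subset.1 hW
  have hwR' : w ∉ R := fun h => hwR h.2
  -- If `R` and `w` spanned `W`, then `w` would be orthogonal to all of `W`, since the form is
  -- alternating; so both inclusions `R < R + Fw < W` are strict.
  have h1 : R < R ⊔ F ∙ w := by
    refine lt_of_le_of_ne le_sup_left fun h => hwR' ?_
    rw [h]; exact Submodule.mem_sup_right (Submodule.mem_span_singleton_self w)
  have h2 : R ⊔ F ∙ w < W := by
    refine lt_of_le_of_ne (sup_le hRW ((Submodule.span_singleton_le_iff_mem _ _).2 hw)) fun h => hwR ?_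
    refine (LinearMap.BilinForm.mem_orthogonal_iff).2 fun n hn => ?_
    rw [← h] at hn
    obtain ⟨r, hr, v, hv, rfl⟩ := Submodule.mem_sup.1 hn
    obtain ⟨c, rfl⟩ := Submodule.mem_span_singleton.1 hv
    have hrw : f.polarBilin w r = 0 := (LinearMap.BilinForm.mem_orthogonal_iff).1 hr.2 w hw
    rw [QuadraticMap.polarBilin_apply_apply, QuadraticMap.polar_comm,
      ← QuadraticMap.polarBilin_apply_apply] at hrw
    rw [map_add, LinearMap.add_apply, hrw, map_smul, LinearMap.smul_apply,
      polarBilin_self_charTwo, smul_zero, add_zero]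
  have := Submodule.finrank_lt_finrank_of_lt h1
  have := Submodule.finrank_lt_finrank_of_lt h2
  omega

end CharTwo

/-! ### Character sums of a quadratic form on subspaces -/

section CharSum

open Finset
open scoped Classical

variable {F V : Type*} [Field F] [Fintype F] [AddCommGroup V] [Module F V] [Fintype V]

theorem card_filter_mem_submodule (W : Submodule F V) :
    #{x | x ∈ W} = Fintype.card F ^ Module.finrank F W := by
  rw [← Module.card_eq_pow_finrank (K := F) (V := W), Fintype.card_subtype]

theorem sum_addChar_linear (χ : AddChar F ℤ) (hχ : χ ≠ 1) (U : Submodule F V)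
    (l : V →ₗ[F] F) :
    ∑ y with y ∈ U, χ (l y) =
      if ∀ y ∈ U, l y = 0 then (Fintype.card F : ℤ) ^ Module.finrank F U else 0 := by
  split_ifs with h
  · rw [sum_congr rfl (g := fun _ => (1 : ℤ))]
    · rw [sum_const, card_filter_mem_submodule]; simp
    · intro y hy
      rw [h y (by simpa using hy), AddChar.map_zero_eq_one]
  · push Not at h
    obtain ⟨y, hy, hly⟩ := h
    obtain ⟨c, hc⟩ := AddChar.ne_one_iff.1 hχ
    have hz : l ((c / l y) • y) = c := by rw [map_smul, smul_eq_mul, div_mul_cancel₀ _ hly]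
    have hzU : (c / l y) • y ∈ U := U.smul_mem _ hy
    set z := (c / l y) • y
    -- Translation by `z`, where `l z = c` and `χ c ≠ 1`, multiplies the sum by `χ c`.
    have key : ∑ y with y ∈ U, χ (l y) = χ c * ∑ y with y ∈ U, χ (l y) := by
      rw [mul_sum]
      refine sum_nbij' (fun x => x - z) (fun x => x + z) ?_ ?_ ?_ ?_ ?_
      · intro x hx; simp only [mem_filter, mem_univ, true_and] at hx ⊢; exact U.sub_mem hx hzU
      · intro x hx; simp only [mem_filter, mem_univ, true_and] at hx ⊢; exact U.add_mem hx hzU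
      · intro x _; simp
      · intro x _; simp
      · intro x _
        rw [← AddChar.map_add_eq_mul, map_sub, hz, add_sub_cancel]
    have : (1 - χ c) * ∑ y with y ∈ U, χ (l y) = 0 := by rw [sub_mul, one_mul, ← key, sub_self]
    rcases mul_eq_zero.1 this with h | h
    · exact absurd (by linarith) hc
    · exact h

variable [CharP F 2]

theorem quadraticCharSum_le (χ : AddChar F ℤ) (f : QuadraticForm F V) (W : Submodule F V) :
    quadraticCharSum χ f W ≤ (Fintype.card F : ℤ) ^ Module.finrank F W := by
  have := sum_le_card_nsmul ({x | x ∈ W} : Finset V) (fun x => χ (f x)) 1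
    fun x _ => addChar_int_le_one χ _
  rw [card_filter_mem_submodule] at this
  simpa [quadraticCharSum] using this

/-- Poisson summation for a quadratic form in characteristic two. -/
theorem card_mul_quadraticCharSum_inf_orthogonal (χ : AddChar F ℤ) (hχ : χ ≠ 1)
    (f : QuadraticForm F V) {U W : Submodule F V} (hUW : U ≤ W) :
    (Fintype.card F : ℤ) ^ Module.finrank F U *
        quadraticCharSum χ f (W ⊓ LinearMap.BilinForm.orthogonal f.polarBilin U) =
      quadraticCharSum χ f W * quadraticCharSum χ f U := by
  have h1 : ∑ x with x ∈ W, ∑ y with y ∈ U, χ (f x) * χ (f.polarBilin y x) =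
      (Fintype.card F : ℤ) ^ Module.finrank F U *
        quadraticCharSum χ f (W ⊓ LinearMap.BilinForm.orthogonal f.polarBilin U) := by
    have : ∀ x : V, ∑ y with y ∈ U, χ (f x) * χ (f.polarBilin y x) =
        if x ∈ LinearMap.BilinForm.orthogonal f.polarBilin U then
          (Fintype.card F : ℤ) ^ Module.finrank F U * χ (f x) else 0 := by
      intro x
      rw [← mul_sum]
      have key := sum_addChar_linear χ hχ U (f.polarBilin.flip x)
      simp only [LinearMap.BilinForm.mem_orthogonal_iff]
      by_cases h : ∀ y ∈ U, f.polarBilin y x = 0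
      · rw [if_pos h, mul_comm]
        exact congrArg (· * χ (f x)) (key.trans (if_pos h))
      · rw [if_neg h, show ∑ y with y ∈ U, χ (f.polarBilin y x) = 0 from key.trans (if_neg h),
          mul_zero]
    simp_rw [this]
    rw [← sum_filter, filter_filter, quadraticCharSum, mul_sum]
    simp only [Submodule.mem_inf]
  have h2 : ∑ x with x ∈ W, ∑ y with y ∈ U, χ (f x) * χ (f.polarBilin y x) =
      quadraticCharSum χ f W * quadraticCharSum χ f U := by
    rw [sum_comm, quadraticCharSum, quadraticCharSum, sum_mul_sum, sum_comm (s := ({x | x ∈ W} : Finset V))]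
    refine sum_congr rfl fun y hy => ?_
    have hyW : y ∈ W := hUW (by simpa using hy)
    -- Since `f x + B(y, x) = f (y + x) + f y`, translating by `y ∈ U ≤ W` separates the variables.
    refine sum_nbij' (fun x => y + x) (fun x => -y + x) ?_ ?_ ?_ ?_ ?_
    · intro x hx; simp only [mem_filter, mem_univ, true_and] at hx ⊢; exact W.add_mem hyW hx
    · intro x hx; simp only [mem_filter, mem_univ, true_and] at hx ⊢
      exact W.add_mem (W.neg_mem hyW) hx
    · intro x _; simp
    · intro x _; simp
    · intro x _
      rw [← AddChar.map_add_eq_mul, ← AddChar.map_add_eq_mul, map_add_charTwo]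
  rw [← h1, h2]

/-- Poisson summation with `U = W` reads `q^dim W * S = S^2` here. -/
theorem quadraticCharSum_nonneg_of_le (χ : AddChar F ℤ) (hχ : χ ≠ 1)
    (f : QuadraticForm F V) {W : Submodule F V}
    (hW : W ≤ LinearMap.BilinForm.orthogonal f.polarBilin W) : 0 ≤ quadraticCharSum χ f W := by
  have h := card_mul_quadraticCharSum_inf_orthogonal χ hχ f (le_refl W)
  rw [inf_eq_left.2 hW] at h
  have hq : (0 : ℤ) < (Fintype.card F : ℤ) ^ Module.finrank F W := by
    have := Fintype.card_pos (α := F); positivity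
  by_contra hneg
  push Not at hneg
  nlinarith

theorem quadraticCharSum_nonneg_of_finrank_le_one (χ : AddChar F ℤ) (hχ : χ ≠ 1)
    (f : QuadraticForm F V) {W : Submodule F V} (hW : Module.finrank F W ≤ 1) :
    0 ≤ quadraticCharSum χ f W := by
  refine quadraticCharSum_nonneg_of_le χ hχ f ?_
  by_contra h
  have := finrank_inf_orthogonal_add_two_le f h
  omega

theorem neg_quadraticCharSum_le (χ : AddChar F ℤ) (hχ : χ ≠ 1)
    (f : QuadraticForm F V) (W : Submodule F V) :
    -quadraticCharSum χ f W ≤ (Fintype.card F : ℤ) ^ (Module.finrank F W - 1) := by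
  have hq : (0 : ℤ) < (Fintype.card F : ℤ) := by
    have := Fintype.card_pos (α := F); positivity
  by_cases hW : W ≤ LinearMap.BilinForm.orthogonal f.polarBilin W
  · have := quadraticCharSum_nonneg_of_le χ hχ f hW
    have : (0 : ℤ) < (Fintype.card F : ℤ) ^ (Module.finrank F W - 1) := by positivity
    linarith
  · have hr := finrank_inf_orthogonal_add_two_le f hW
    have h := card_mul_quadraticCharSum_inf_orthogonal χ hχ f (le_refl W)
    have hR := quadraticCharSum_le χ f (W ⊓ LinearMap.BilinForm.orthogonal f.polarBilin W)
    have hR' : quadraticCharSum χ f (W ⊓ LinearMap.BilinForm.orthogonal f.polarBilin W) ≤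
        (Fintype.card F : ℤ) ^ (Module.finrank F W - 2) :=
      hR.trans (pow_le_pow_right₀ (by omega) (by omega))
    -- `S(W)^2 = q^s * S(R) ≤ q^s * q^(s-2)`, with `s = dim W` and `R` its radical.
    refine (neg_le_abs _).trans (abs_le_of_sq_le_sq ?_ (by positivity))
    rw [sq, ← h]
    calc _ ≤ (Fintype.card F : ℤ) ^ Module.finrank F W *
          (Fintype.card F : ℤ) ^ (Module.finrank F W - 2) := by gcongr
      _ = _ := by rw [← pow_add, ← pow_mul]; congr 1; omega

theorem quadraticCharSum_mul_left (χ : AddChar F ℤ) (f : QuadraticForm F V)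
    (W : Submodule F V) {c : F} (hc : c ≠ 0) :
    ∑ x with x ∈ W, χ (c * f x) = quadraticCharSum χ f W := by
  obtain ⟨d, rfl⟩ := (FiniteField.isSquare_of_char_two (ringChar.eq F 2) c)
  have hd : d ≠ 0 := by rintro rfl; simp at hc
  rw [quadraticCharSum]
  refine sum_nbij' (fun x => d • x) (fun x => d⁻¹ • x) ?_ ?_ ?_ ?_ ?_
  · intro x hx; simp only [mem_filter, mem_univ, true_and] at hx ⊢; exact W.smul_mem _ hx
  · intro x hx; simp only [mem_filter, mem_univ, true_and] at hx ⊢; exact W.smul_mem _ hx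
  · intro x _; simp [smul_smul, hd]
  · intro x _; simp [smul_smul, hd]
  · intro x _; simp [QuadraticMap.map_smul]

theorem card_mul_levelCount (χ : AddChar F ℤ) (hχ : χ ≠ 1) (f : QuadraticForm F V)
    (W : Submodule F V) (b : F) :
    (Fintype.card F : ℤ) * levelCount f b W =
      (Fintype.card F : ℤ) ^ Module.finrank F W +
        (if b = 0 then (Fintype.card F : ℤ) - 1 else -1) * quadraticCharSum χ f W := by
  have hprim := AddChar.IsPrimitive.of_ne_one hχ
  -- The sum over `c` detects `f x = b`; interchanging sums leaves one copy of `S(W)` for each `c ≠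
  -- 0`.
  have h1 : ∑ x with x ∈ W, ∑ c, χ (c * (f x - b)) = (Fintype.card F : ℤ) * levelCount f b W := by
    simp_rw [AddChar.sum_mulShift _ hprim, sub_eq_zero, Nat.cast_ite, Nat.cast_zero]
    rw [← sum_filter, filter_filter, sum_const, levelCount, nsmul_eq_mul, mul_comm]
  have h2 : ∀ c : F, ∑ x with x ∈ W, χ (c * (f x - b)) =
      χ (c * b) * quadraticCharSum χ f W +
        if c = 0 then (Fintype.card F : ℤ) ^ Module.finrank F W - quadraticCharSum χ f W
          else 0 := by
    intro c
    by_cases hc : c = 0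
    · subst hc
      simp [card_filter_mem_submodule]
    · rw [if_neg hc, add_zero, ← quadraticCharSum_mul_left χ f W hc, mul_sum]
      refine sum_congr rfl fun x _ => ?_
      rw [← AddChar.map_add_eq_mul, CharTwo.sub_eq_add, mul_add, add_comm]
  rw [← h1, sum_comm]
  simp_rw [h2]
  rw [sum_add_distrib, ← sum_mul, AddChar.sum_mulShift _ hprim, sum_ite_eq' univ (0 : F)]
  simp only [mem_univ, if_true]
  split_ifs <;> push_cast <;> ring

end CharSum

theorem polarBilin_isRefl {F V : Type*} [Field F] [AddCommGroup V] [Module F V]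
    (f : QuadraticForm F V) : f.polarBilin.IsRefl := by
  intro x y h
  rwa [QuadraticMap.polarBilin_apply_apply, QuadraticMap.polar_comm,
      ← QuadraticMap.polarBilin_apply_apply] at h

theorem Submodule.exists_finrank_eq_of_le (F : Type*) {V : Type*} [Field F] [AddCommGroup V]
    [Module F V] [FiniteDimensional F V] {r : ℕ} (hr : r ≤ Module.finrank F V) :
    ∃ T : Submodule F V, Module.finrank F T = r := by
  let b := Module.finBasis F V
  have := b.linearIndependent.comp (Fin.castLE hr) (Fin.castLE_injective hr)
  exact ⟨Submodule.span F (Set.range (b ∘ Fin.castLE hr)), by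
    rw [finrank_span_eq_card this, Fintype.card_fin]⟩

/-! ### The hyperbolic space -/

section Hyperbolic

open Finset
open scoped Classical

theorem IsEquivalentToTypeI.exists_linearEquiv {F V : Type*} [Field F] [AddCommGroup V]
    [Module F V] [FiniteDimensional F V] {f : QuadraticForm F V} (hf : f.radical = ⊥)
    (hI : IsEquivalentToTypeI f) :
    ∃ (k : ℕ) (φ : V ≃ₗ[F] (Fin k → F) × (Fin k → F)), ∀ x, f x = (φ x).1 ⬝ᵥ (φ x).2 := by
  obtain ⟨k, hk, b, hb⟩ := hI
  let φ : V →ₗ[F] (Fin k → F) × (Fin k → F) :=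
    (LinearMap.pi fun i : Fin k => b.coord ⟨2 * (i : ℕ), by omega⟩).prod
      (LinearMap.pi fun i : Fin k => b.coord ⟨2 * (i : ℕ) + 1, by omega⟩)
  have hφ : ∀ x, f x = (φ x).1 ⬝ᵥ (φ x).2 := hb
  -- A vector whose first `2 * k` coordinates vanish lies in the radical, so nondegeneracy forces `2
  -- * k` to be the full dimension.
  have hinj : Function.Injective φ := by
    rw [injective_iff_map_eq_zero]
    intro x hx
    have : x ∈ f.radical := by
      refine QuadraticMap.mem_radical_iff'.2 ⟨?_, fun y => ?_⟩
      · rw [hφ, hx]; simp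
      · rw [hφ, hφ, map_add, hx, zero_add]
    rwa [hf, Submodule.mem_bot] at this
  have hle := LinearMap.finrank_le_finrank_of_injective hinj
  have hdim : Module.finrank F ((Fin k → F) × (Fin k → F)) = 2 * k := by
    simp [Module.finrank_prod, two_mul]
  refine ⟨k, LinearEquiv.ofInjectiveOfFinrankEq φ hinj (by omega), fun x => ?_⟩
  rw [hφ]
  rfl

variable {F V : Type*} [Field F] [AddCommGroup V] [Module F V]
  {k : ℕ} {f : QuadraticForm F V} (φ : V ≃ₗ[F] (Fin k → F) × (Fin k → F))

include φ in
theorem finrank_of_linearEquiv_prod : Module.finrank F V = 2 * k := by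
  rw [φ.finrank_eq]; simp [Module.finrank_prod, two_mul]

variable (hφ : ∀ x, f x = (φ x).1 ⬝ᵥ (φ x).2)
include hφ

theorem polarBilin_eq_of_hyperbolic (x y : V) :
    f.polarBilin x y = (φ x).1 ⬝ᵥ (φ y).2 + (φ y).1 ⬝ᵥ (φ x).2 := by
  rw [QuadraticMap.polarBilin_apply_apply, QuadraticMap.polar, hφ, hφ, hφ]
  simp only [map_add, Prod.fst_add, Prod.snd_add, add_dotProduct, dotProduct_add]
  ring

theorem polarBilin_nondegenerate_of_hyperbolic : f.polarBilin.Nondegenerate := by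
  rw [(polarBilin_isRefl f).nondegenerate_iff_separatingLeft]
  intro x hx
  rw [← φ.map_eq_zero_iff]
  refine Prod.ext (funext fun i => ?_) (funext fun i => ?_)
  · have := hx (φ.symm (0, Pi.single i 1))
    simpa [polarBilin_eq_of_hyperbolic φ hφ] using this
  · have := hx (φ.symm (Pi.single i 1, 0))
    simpa [polarBilin_eq_of_hyperbolic φ hφ] using this

theorem exists_eq_of_hyperbolic (hk : 0 < k) (a : F) : ∃ v, f v = a :=
  ⟨φ.symm (Pi.single ⟨0, hk⟩ 1, Pi.single ⟨0, hk⟩ a), by simp [hφ]⟩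

variable [Fintype F] [Fintype V]

theorem quadraticCharSum_top_of_hyperbolic (χ : AddChar F ℤ) (hχ : χ ≠ 1) :
    quadraticCharSum χ f ⊤ = (Fintype.card F : ℤ) ^ k := by
  have h : ∀ u : Fin k → F, ∑ v, χ (u ⬝ᵥ v) =
      if u = 0 then (Fintype.card F : ℤ) ^ k else 0 := by
    intro u
    have := sum_addChar_linear χ hχ ⊤ (dotProductBilin F F u)
    have hu : (∀ y ∈ (⊤ : Submodule F (Fin k → F)), (dotProductBilin F F u) y = 0) ↔ u = 0 := by
      constructor
      · intro h
        funext i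
        simpa using h (Pi.single i 1) trivial
      · rintro rfl; simp
    simp only [hu] at this
    simpa using this
  calc quadraticCharSum χ f ⊤ = ∑ p : (Fin k → F) × (Fin k → F), χ (p.1 ⬝ᵥ p.2) := by
        rw [quadraticCharSum]
        simp only [Submodule.mem_top, filter_true, hφ]
        exact Equiv.sum_comp φ.toEquiv fun p => χ (p.1 ⬝ᵥ p.2)
    _ = _ := by
        rw [Fintype.sum_prod_type]
        simp [h]

variable [CharP F 2]

theorem quadraticCharSum_orthogonal_of_hyperbolic (χ : AddChar F ℤ) (hχ : χ ≠ 1)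
    (U : Submodule F V) :
    (Fintype.card F : ℤ) ^ Module.finrank F U *
      quadraticCharSum χ f (LinearMap.BilinForm.orthogonal f.polarBilin U) =
    (Fintype.card F : ℤ) ^ k * quadraticCharSum χ f U := by
  have := card_mul_quadraticCharSum_inf_orthogonal χ hχ f (le_top (a := U))
  rwa [top_inf_eq, quadraticCharSum_top_of_hyperbolic φ hφ χ hχ] at this

end Hyperbolic

/-! ### Anisotropic planes and elliptic subspaces -/

theorem FiniteField.exists_forall_sq_add_self_ne (F : Type*) [Field F] [Finite F] [CharP F 2] :
    ∃ c : F, ∀ t : F, t ^ 2 + t ≠ c := by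
  by_contra! h
  have hinj : Function.Injective fun t : F => t ^ 2 + t := Finite.injective_iff_surjective.2 h
  have : (0 : F) = 1 := hinj (by simp [CharTwo.add_self_eq_zero])
  exact zero_ne_one this

/-- A zero with `y ≠ 0` would make `t = x / y` a solution of `t ^ 2 + t = c`. -/
theorem FiniteField.exists_anisotropic_binary (F : Type*) [Field F] [Finite F] [CharP F 2] :
    ∃ c : F, ∀ x y : F, x ^ 2 + x * y + c * y ^ 2 = 0 → x = 0 ∧ y = 0 := by
  obtain ⟨c, hc⟩ := FiniteField.exists_forall_sq_add_self_ne F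
  refine ⟨c, fun x y h => ?_⟩
  by_cases hy : y = 0
  · subst hy; simpa using h
  · refine absurd ?_ (hc (x / y))
    field_simp
    have h2 := CharTwo.two_eq_zero (R := F)
    linear_combination h - c * y ^ 2 * h2

section Elliptic

open Finset
open scoped Classical

variable {F V : Type*} [Field F] [AddCommGroup V] [Module F V]
  {k : ℕ} {f : QuadraticForm F V} (φ : V ≃ₗ[F] (Fin k → F) × (Fin k → F))

/-- A parametrization of an anisotropic plane plus a totally singular subspace of the
hyperbolic space. -/
def ellipticMap (c : F) {j : ℕ} (T : Submodule F (Fin j → F)) :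
    F × F × T →ₗ[F] (Fin (j + 2) → F) × (Fin (j + 2) → F) where
  toFun p := (Matrix.vecCons (p.1 + p.2.1) (Matrix.vecCons p.2.1 p.2.2),
    Matrix.vecCons p.1 (Matrix.vecCons (c * p.2.1) 0))
  map_add' p p' := by
    simp [mul_add, add_add_add_comm]
  map_smul' d p := by
    simp [mul_add, mul_left_comm]

theorem ellipticMap_injective (c : F) {j : ℕ} (T : Submodule F (Fin j → F)) :
    Function.Injective (ellipticMap c T) := by
  rw [injective_iff_map_eq_zero]
  rintro ⟨x, y, t⟩ h
  obtain ⟨h1, h2⟩ := Prod.ext_iff.1 h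
  have hx : x = 0 := congrFun h2 0
  have hy : y = 0 := congrFun h1 1
  have ht : t = 0 := Subtype.ext (funext fun i => congrFun h1 i.succ.succ)
  rw [hx, hy, ht, Prod.mk_zero_zero, Prod.mk_zero_zero]

theorem ellipticMap_dotProduct (c : F) {j : ℕ} (T : Submodule F (Fin j → F)) (p : F × F × T) :
    (ellipticMap c T p).1 ⬝ᵥ (ellipticMap c T p).2 =
      p.1 ^ 2 + p.1 * p.2.1 + c * p.2.1 ^ 2 := by
  simp [ellipticMap]
  ring

variable [Fintype F] [Fintype V] [CharP F 2]

/-- Anisotropy of the plane leaves exactly the summand `T`, of dimension `s - 2`, as the zeros of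
`f`. Two hyperbolic pairs carry the plane, and `T` fits in the remaining `k - 2`. -/
theorem exists_levelCount_zero_eq (hφ : ∀ x, f x = (φ x).1 ⬝ᵥ (φ x).2) {s : ℕ}
    (hs : 2 ≤ s) (hsk : s ≤ k) :
    ∃ W : Submodule F V, Module.finrank F W = s ∧
      levelCount f 0 W = Fintype.card F ^ (s - 2) := by
  obtain ⟨j, rfl⟩ : ∃ j, k = j + 2 := ⟨k - 2, by omega⟩
  obtain ⟨c, hc⟩ := FiniteField.exists_anisotropic_binary F
  obtain ⟨T, hT⟩ : ∃ T : Submodule F (Fin j → F), Module.finrank F T = s - 2 := by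
    exact Submodule.exists_finrank_eq_of_le F (by rw [Module.finrank_fin_fun]; omega)
  let ψ : F × F × T →ₗ[F] V := φ.symm.toLinearMap ∘ₗ ellipticMap c T
  have hψ : Function.Injective ψ := φ.symm.injective.comp (ellipticMap_injective c T)
  have hfψ : ∀ p, f (ψ p) = p.1 ^ 2 + p.1 * p.2.1 + c * p.2.1 ^ 2 := by
    intro p
    rw [hφ, ← ellipticMap_dotProduct]
    simp [ψ]
  refine ⟨LinearMap.range ψ, ?_, ?_⟩
  · rw [LinearMap.finrank_range_of_inj hψ]
    simp [Module.finrank_prod, hT]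
    omega
  · rw [← hT, ← Module.card_eq_pow_finrank (K := F) (V := T), levelCount, ← card_univ]
    symm
    refine card_nbij (fun t => ψ (0, 0, t)) ?_ ?_ ?_
    · intro t _
      refine mem_coe.2 (mem_filter.2 ⟨mem_univ _, LinearMap.mem_range_self _ _, ?_⟩)
      simp [hfψ]
    · intro t _ t' _ h
      simpa using hψ h
    · rintro v hv
      simp only [coe_filter, mem_univ, true_and, Set.mem_ofPred_eq] at hv
      obtain ⟨⟨⟨x, y, t⟩, rfl⟩, hv⟩ := hv
      rw [hfψ] at hv
      obtain ⟨rfl, rfl⟩ := hc x y hv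
      exact ⟨t, by simp, rfl⟩

end Elliptic

/-! ### Largest level sets on subspaces of each dimension -/

section Extremal

open scoped Classical

variable {F V : Type*} [Field F] [AddCommGroup V] [Module F V] [Fintype V]
  {k : ℕ} {f : QuadraticForm F V} {a : F}

theorem isGreatest_levelCount_zero (f : QuadraticForm F V) (ha : a ≠ 0) :
    IsGreatest {N | ∃ W : Submodule F V, Module.finrank F W = 0 ∧ levelCount f a W = N} 0 := by
  have h : ∀ W : Submodule F V, Module.finrank F W = 0 → levelCount f a W = 0 := by
    intro W hW
    rw [Submodule.finrank_eq_zero] at hW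
    subst hW
    simp only [levelCount, Finset.card_eq_zero, Finset.filter_eq_empty_iff, Submodule.mem_bot]
    rintro x - ⟨rfl, h⟩
    exact ha (by rw [← h, QuadraticMap.map_zero])
  exact ⟨⟨⊥, finrank_bot F V, h _ (finrank_bot F V)⟩, by rintro _ ⟨W, hW, rfl⟩; exact (h W hW).le⟩

theorem finrank_orthogonal_of_hyperbolic (φ : V ≃ₗ[F] (Fin k → F) × (Fin k → F))
    (hφ : ∀ x, f x = (φ x).1 ⬝ᵥ (φ x).2) (W : Submodule F V) :
    Module.finrank F (LinearMap.BilinForm.orthogonal f.polarBilin W) =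
      2 * k - Module.finrank F W := by
  rw [LinearMap.BilinForm.finrank_orthogonal (polarBilin_nondegenerate_of_hyperbolic φ hφ),
    finrank_of_linearEquiv_prod φ]

theorem orthogonal_orthogonal_of_hyperbolic (φ : V ≃ₗ[F] (Fin k → F) × (Fin k → F))
    (hφ : ∀ x, f x = (φ x).1 ⬝ᵥ (φ x).2) (W : Submodule F V) :
    LinearMap.BilinForm.orthogonal f.polarBilin
      (LinearMap.BilinForm.orthogonal f.polarBilin W) = W :=
  LinearMap.BilinForm.orthogonal_orthogonal (polarBilin_nondegenerate_of_hyperbolic φ hφ)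
    (polarBilin_isRefl f) W

variable [Fintype F] [CharP F 2]

/-- The excess of the count over its mean value `q^s` is `-S(W) / q`. -/
theorem levelCount_le_of_neg_quadraticCharSum_le (ha : a ≠ 0) {χ : AddChar F ℤ} (hχ : χ ≠ 1)
    {W : Submodule F V} {s : ℕ} (hs : Module.finrank F W = s + 1) {M : ℕ}
    (h : -quadraticCharSum χ f W ≤ (Fintype.card F : ℤ) * M) :
    levelCount f a W ≤ Fintype.card F ^ s + M := by
  have hq : (0 : ℤ) < Fintype.card F := by exact_mod_cast Fintype.card_pos (α := F)
  have := card_mul_levelCount χ hχ f W a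
  rw [if_neg ha, hs, pow_succ] at this
  zify
  refine le_of_mul_le_mul_left ?_ hq
  linarith

theorem levelCount_eq_of_neg_quadraticCharSum_eq (ha : a ≠ 0) {χ : AddChar F ℤ} (hχ : χ ≠ 1)
    {W : Submodule F V} {s : ℕ} (hs : Module.finrank F W = s + 1) {M : ℕ}
    (h : -quadraticCharSum χ f W = (Fintype.card F : ℤ) * M) :
    levelCount f a W = Fintype.card F ^ s + M := by
  have hq : (Fintype.card F : ℤ) ≠ 0 := by exact_mod_cast Fintype.card_ne_zero (α := F)
  have := card_mul_levelCount χ hχ f W a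
  rw [if_neg ha, hs, pow_succ] at this
  zify
  refine mul_left_cancel₀ hq ?_
  linarith

variable (φ : V ≃ₗ[F] (Fin k → F) × (Fin k → F)) (hφ : ∀ x, f x = (φ x).1 ⬝ᵥ (φ x).2)
include hφ

theorem levelCount_top_of_hyperbolic (hk : 0 < k) (ha : a ≠ 0) :
    (levelCount f a ⊤ : ℤ) =
      (Fintype.card F : ℤ) ^ (2 * k - 1) - (Fintype.card F : ℤ) ^ (k - 1) := by
  obtain ⟨χ, hχ⟩ := exists_addChar_int_ne_one F
  have hq : (Fintype.card F : ℤ) ≠ 0 := by exact_mod_cast Fintype.card_ne_zero (α := F)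
  have h := card_mul_levelCount χ hχ f ⊤ a
  rw [if_neg ha, finrank_top, finrank_of_linearEquiv_prod φ,
    quadraticCharSum_top_of_hyperbolic φ hφ χ hχ] at h
  obtain ⟨j, rfl⟩ : ∃ j, k = j + 1 := ⟨k - 1, by omega⟩
  refine mul_left_cancel₀ hq ?_
  rw [h, show 2 * (j + 1) - 1 = 2 * j + 1 by omega, Nat.add_sub_cancel]
  ring

/-- On the line through a vector with `f v = 1` only 0 is singular, so counting zeros gives `q = q +
(q - 1) * S`. -/
theorem exists_quadraticCharSum_eq_zero (hk : 0 < k) {χ : AddChar F ℤ} (hχ : χ ≠ 1) :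
    ∃ U : Submodule F V, Module.finrank F U = 1 ∧ quadraticCharSum χ f U = 0 := by
  obtain ⟨v, hv⟩ := exists_eq_of_hyperbolic φ hφ hk 1
  have hv0 : v ≠ 0 := by rintro rfl; simp at hv
  refine ⟨F ∙ v, finrank_span_singleton hv0, ?_⟩
  have h := card_mul_levelCount χ hχ f (F ∙ v) 0
  have h0 : levelCount f 0 (F ∙ v) = 1 := by
    rw [levelCount, Finset.card_eq_one]
    refine ⟨0, Finset.ext fun x => ?_⟩
    simp only [Finset.mem_filter, Finset.mem_univ, true_and, Finset.mem_singleton,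
      Submodule.mem_span_singleton]
    constructor
    · rintro ⟨⟨c, rfl⟩, hx⟩
      rw [QuadraticMap.map_smul, hv, smul_eq_mul, mul_one, mul_self_eq_zero] at hx
      rw [hx, zero_smul]
    · rintro rfl
      exact ⟨⟨0, zero_smul _ _⟩, QuadraticMap.map_zero f⟩
  rw [h0, finrank_span_singleton hv0, if_pos rfl] at h
  have hq : (1 : ℤ) < Fintype.card F := by exact_mod_cast Fintype.one_lt_card (α := F)
  have : ((Fintype.card F : ℤ) - 1) * quadraticCharSum χ f (F ∙ v) = 0 := by
    push_cast at h; linarith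
  exact (mul_eq_zero.1 this).resolve_left (by omega)

theorem exists_neg_quadraticCharSum_eq {χ : AddChar F ℤ} (hχ : χ ≠ 1) {s : ℕ}
    (hs : 2 ≤ s) (hsk : s ≤ k) :
    ∃ U : Submodule F V, Module.finrank F U = s ∧
      -quadraticCharSum χ f U = (Fintype.card F : ℤ) ^ (s - 1) := by
  obtain ⟨U, hU, hN⟩ := exists_levelCount_zero_eq φ hφ hs hsk
  refine ⟨U, hU, ?_⟩
  obtain ⟨j, rfl⟩ : ∃ j, s = j + 2 := ⟨s - 2, by omega⟩
  have h := card_mul_levelCount χ hχ f U 0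
  have hq : (1 : ℤ) < Fintype.card F := by exact_mod_cast Fintype.one_lt_card (α := F)
  rw [hN, hU, if_pos rfl] at h
  refine mul_left_cancel₀ (show (Fintype.card F : ℤ) - 1 ≠ 0 by omega) ?_
  simp only [Nat.add_sub_cancel, show j + 2 - 1 = j + 1 by omega] at h ⊢
  push_cast at h
  linear_combination h

theorem isGreatest_levelCount_one (hk : 0 < k) (ha : a ≠ 0) :
    IsGreatest {N | ∃ W : Submodule F V, Module.finrank F W = 1 ∧ levelCount f a W = N} 1 := by
  obtain ⟨χ, hχ⟩ := exists_addChar_int_ne_one F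
  constructor
  · obtain ⟨U, hU, hS⟩ := exists_quadraticCharSum_eq_zero φ hφ hk hχ
    refine ⟨U, hU, ?_⟩
    have := levelCount_eq_of_neg_quadraticCharSum_eq (f := f) ha hχ (s := 0) (M := 0) hU
      (by simp [hS])
    simpa using this
  · rintro _ ⟨W, hW, rfl⟩
    have := levelCount_le_of_neg_quadraticCharSum_le (f := f) ha hχ (s := 0) (M := 0) hW (by
      simpa using quadraticCharSum_nonneg_of_finrank_le_one χ hχ f hW.le)
    simpa using this

theorem isGreatest_levelCount_of_le {s : ℕ} (hs : 2 ≤ s) (hsk : s ≤ k) (ha : a ≠ 0) :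
    IsGreatest {N | ∃ W : Submodule F V, Module.finrank F W = s ∧ levelCount f a W = N}
      (Fintype.card F ^ (s - 1) + Fintype.card F ^ (s - 2)) := by
  obtain ⟨χ, hχ⟩ := exists_addChar_int_ne_one F
  obtain ⟨j, rfl⟩ : ∃ j, s = j + 2 := ⟨s - 2, by omega⟩
  constructor
  · obtain ⟨U, hU, hS⟩ := exists_neg_quadraticCharSum_eq φ hφ hχ hs hsk
    refine ⟨U, hU, levelCount_eq_of_neg_quadraticCharSum_eq ha hχ hU ?_⟩
    rw [hS]
    push_cast
    rw [← pow_succ']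
  · rintro _ ⟨W, hW, rfl⟩
    refine levelCount_le_of_neg_quadraticCharSum_le ha hχ hW ?_
    refine (neg_quadraticCharSum_le χ hχ f W).trans_eq ?_
    rw [hW]
    push_cast
    rw [← pow_succ']

theorem isGreatest_levelCount_of_ge {s : ℕ} (hks : k ≤ s) (hs : s + 2 ≤ 2 * k) (ha : a ≠ 0) :
    IsGreatest {N | ∃ W : Submodule F V, Module.finrank F W = s ∧ levelCount f a W = N}
      (Fintype.card F ^ (s - 1) + Fintype.card F ^ (k - 2)) := by
  obtain ⟨χ, hχ⟩ := exists_addChar_int_ne_one F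
  have hq : (0 : ℤ) < Fintype.card F := by exact_mod_cast Fintype.card_pos (α := F)
  -- Duality turns the extreme value `q^(2k-s-1)` in dimension `2k - s` into `q^(k-1)` in dimension
  -- `s`. The hypotheses force `k ≥ 2`, so `k - 2` is not truncated.
  have hpow : (Fintype.card F : ℤ) ^ (2 * k - s) * (Fintype.card F * ↑(Fintype.card F ^ (k - 2))) =
      (Fintype.card F : ℤ) ^ k * (Fintype.card F : ℤ) ^ (2 * k - s - 1) := by
    push_cast
    rw [← pow_succ', ← pow_add, ← pow_add]
    congr 1; omega
  constructor
  · obtain ⟨U, hU, hS⟩ := exists_neg_quadraticCharSum_eq φ hφ hχ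
      (show 2 ≤ 2 * k - s by omega) (by omega)
    have hU' : Module.finrank F (LinearMap.BilinForm.orthogonal f.polarBilin U) = s - 1 + 1 := by
      rw [finrank_orthogonal_of_hyperbolic φ hφ, hU]; omega
    refine ⟨_, by rw [hU']; omega, levelCount_eq_of_neg_quadraticCharSum_eq ha hχ hU' ?_⟩
    have := quadraticCharSum_orthogonal_of_hyperbolic φ hφ χ hχ U
    refine mul_left_cancel₀ (pow_pos hq (2 * k - s)).ne' ?_
    rw [hpow, ← hS, ← hU, mul_neg, mul_neg, this]
  · rintro _ ⟨W, hW, rfl⟩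
    refine levelCount_le_of_neg_quadraticCharSum_le ha hχ (s := s - 1) (by omega) ?_
    set U := LinearMap.BilinForm.orthogonal f.polarBilin W
    have hU : Module.finrank F U = 2 * k - s := by
      rw [finrank_orthogonal_of_hyperbolic φ hφ, hW]
    have h1 := quadraticCharSum_orthogonal_of_hyperbolic φ hφ χ hχ U
    rw [orthogonal_orthogonal_of_hyperbolic φ hφ] at h1
    have h2 := neg_quadraticCharSum_le χ hχ f U
    rw [hU] at h1 h2
    refine le_of_mul_le_mul_left ?_ (pow_pos hq (2 * k - s))
    rw [hpow, mul_neg, h1, ← mul_neg]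
    exact mul_le_mul_of_nonneg_left h2 (by positivity)

/-- The orthogonal of a hyperplane is a line, where `S ≥ 0`; duality preserves the sign and the
value 0. -/
theorem isGreatest_levelCount_hyperplane (hk : 0 < k) (ha : a ≠ 0) :
    IsGreatest {N | ∃ W : Submodule F V, Module.finrank F W = 2 * k - 1 ∧ levelCount f a W = N}
      (Fintype.card F ^ (2 * k - 2)) := by
  obtain ⟨χ, hχ⟩ := exists_addChar_int_ne_one F
  have hq : (0 : ℤ) < Fintype.card F := by exact_mod_cast Fintype.card_pos (α := F)
  constructor
  · obtain ⟨U, hU, hS⟩ := exists_quadraticCharSum_eq_zero φ hφ hk hχ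
    have hU' : Module.finrank F (LinearMap.BilinForm.orthogonal f.polarBilin U) =
        2 * k - 2 + 1 := by
      rw [finrank_orthogonal_of_hyperbolic φ hφ, hU]; omega
    refine ⟨_, by rw [hU']; omega,
      levelCount_eq_of_neg_quadraticCharSum_eq ha hχ (M := 0) hU' ?_⟩
    have := quadraticCharSum_orthogonal_of_hyperbolic φ hφ χ hχ U
    rw [hS, mul_zero] at this
    rw [(mul_eq_zero.1 this).resolve_left (pow_pos hq _).ne']
    simp
  · rintro _ ⟨W, hW, rfl⟩
    refine levelCount_le_of_neg_quadraticCharSum_le ha hχ (s := 2 * k - 2) (M := 0) (by omega) ?_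
    set U := LinearMap.BilinForm.orthogonal f.polarBilin W
    have hU : Module.finrank F U = 1 := by
      rw [finrank_orthogonal_of_hyperbolic φ hφ, hW]; omega
    have h1 := quadraticCharSum_orthogonal_of_hyperbolic φ hφ χ hχ U
    rw [orthogonal_orthogonal_of_hyperbolic φ hφ] at h1
    have h2 := quadraticCharSum_nonneg_of_finrank_le_one χ hχ f hU.le
    have h3 : 0 ≤ quadraticCharSum χ f W := by
      refine nonneg_of_mul_nonneg_right ?_ (pow_pos hq (Module.finrank F U))
      rw [h1]; positivity
    simpa using h3

end Extremal

/-! ### From codes to subspace sections -/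

section Code

variable {F K : Type*} [Field F] [Field K] [Finite K] [Algebra F K]

/-- The encoding map of the code with defining set `D`. -/
noncomputable def definingSetEncode (F : Type*) {K : Type*} [Field F] [Field K] [Algebra F K]
    (D : Set K) : K →ₗ[F] (D → F) :=
  LinearMap.pi fun d : D => (Algebra.trace F K).comp (LinearMap.mulRight F (d : K))

theorem ncard_codeSupport_map_definingSetEncode (D : Set K) (H : Submodule F K) :
    (codeSupport (H.map (definingSetEncode F D))).ncard +
      (D ∩ LinearMap.BilinForm.orthogonal (Algebra.traceForm F K) H).ncard = D.ncard := by
  rw [← Set.ncard_image_of_injective _ Subtype.val_injective,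
    ← Set.ncard_inter_add_ncard_sdiff_eq_ncard D
      (LinearMap.BilinForm.orthogonal (Algebra.traceForm F K) H : Set K), add_comm]
  congr 2
  ext x
  simp only [Set.mem_image, codeSupport, Set.mem_ofPred_eq, Submodule.mem_map, Set.mem_sdiff,
    SetLike.mem_coe, LinearMap.BilinForm.mem_orthogonal_iff, Algebra.traceForm_apply]
  constructor
  · rintro ⟨⟨d, hd⟩, ⟨_, ⟨y, hy, rfl⟩, h⟩, rfl⟩
    exact ⟨hd, fun h' => h (h' y hy)⟩
  · rintro ⟨hx, h⟩
    push Not at h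
    obtain ⟨y, hy, h⟩ := h
    exact ⟨⟨x, hx⟩, ⟨_, ⟨y, hy, rfl⟩, h⟩, rfl⟩

variable [Finite F]

theorem finrank_orthogonal_traceForm (W : Submodule F K) :
    Module.finrank F (LinearMap.BilinForm.orthogonal (Algebra.traceForm F K) W) =
      Module.finrank F K - Module.finrank F W :=
  LinearMap.BilinForm.finrank_orthogonal (traceForm_nondegenerate F K) W

theorem orthogonal_orthogonal_traceForm (W : Submodule F K) :
    LinearMap.BilinForm.orthogonal (Algebra.traceForm F K)
      (LinearMap.BilinForm.orthogonal (Algebra.traceForm F K) W) = W :=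
  LinearMap.BilinForm.orthogonal_orthogonal (traceForm_nondegenerate F K)
    (Algebra.traceForm_isSymm F).isRefl W

/-- A nonzero `x` in the kernel would put all of `D` inside the hyperplane trace-orthogonal to `x`.
-/
theorem definingSetEncode_injective {D : Set K}
    (h : ∀ W : Submodule F K, Module.finrank F W = Module.finrank F K - 1 →
      (D ∩ W).ncard < D.ncard) : Function.Injective (definingSetEncode F D) := by
  rw [injective_iff_map_eq_zero]
  intro x hx
  by_contra hx0
  have h1 := h (LinearMap.BilinForm.orthogonal (Algebra.traceForm F K) (F ∙ x))
    (by rw [finrank_orthogonal_traceForm, finrank_span_singleton hx0])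
  refine h1.ne ?_
  rw [Set.inter_eq_left.2]
  intro d hd
  refine LinearMap.BilinForm.mem_orthogonal_iff.2 fun n hn => ?_
  obtain ⟨c, rfl⟩ := Submodule.mem_span_singleton.1 hn
  have : Algebra.trace F K (x * d) = 0 := congrFun hx ⟨d, hd⟩
  rw [map_smul, LinearMap.smul_apply, Algebra.traceForm_apply, this, smul_zero]

/-- The generalized Hamming weights of the code with defining set `D` are determined by the
largest sections of `D` by subspaces. -/
theorem generalizedHammingWeight_definingSetCode {D : Set K}
    (hinj : Function.Injective (definingSetEncode F D)) {r s M : ℕ}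
    (hr : r + s = Module.finrank F K)
    (hM : IsGreatest {N | ∃ W : Submodule F K, Module.finrank F W = s ∧ (D ∩ W).ncard = N} M) :
    (generalizedHammingWeight (definingSetCode F D) r : ℤ) = D.ncard - M := by
  obtain ⟨⟨W, hW, hWM⟩, hub⟩ := hM
  have hle : M ≤ D.ncard := hWM ▸ Set.ncard_le_ncard Set.inter_subset_left (Set.toFinite _)
  have hleast : IsLeast {w : ℕ | ∃ H : Submodule F (D → F),
      H ≤ definingSetCode F D ∧ Module.finrank F H = r ∧ (codeSupport H).ncard = w}
      (D.ncard - M) := by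
    constructor
    · refine ⟨(LinearMap.BilinForm.orthogonal (Algebra.traceForm F K) W).map
        (definingSetEncode F D), LinearMap.map_le_range, ?_, ?_⟩
      · rw [← LinearEquiv.finrank_eq (Submodule.equivMapOfInjective _ hinj _), finrank_orthogonal_traceForm, hW]; omega
      · have := ncard_codeSupport_map_definingSetEncode D
          (LinearMap.BilinForm.orthogonal (Algebra.traceForm F K) W)
        rw [orthogonal_orthogonal_traceForm, hWM] at this
        omega
    · rintro _ ⟨H, hH, hHr, rfl⟩
      have hmap : (H.comap (definingSetEncode F D)).map (definingSetEncode F D) = H :=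
        Submodule.map_comap_eq_of_le hH
      have hdim : Module.finrank F (H.comap (definingSetEncode F D)) = r := by
        rw [LinearEquiv.finrank_eq (Submodule.equivMapOfInjective _ hinj _), hmap, hHr]
      have h1 := ncard_codeSupport_map_definingSetEncode D (H.comap (definingSetEncode F D))
      rw [hmap] at h1
      have h2 : _ ≤ M := hub ⟨LinearMap.BilinForm.orthogonal (Algebra.traceForm F K)
        (H.comap (definingSetEncode F D)), by
          rw [finrank_orthogonal_traceForm, hdim]; omega, rfl⟩
      omega
  rw [generalizedHammingWeight, hleast.csInf_eq, Nat.cast_sub hle]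

theorem levelCount_eq_ncard {F V : Type*} [Field F] [AddCommGroup V] [Module F V] [Fintype V]
    (f : QuadraticForm F V) (a : F) (W : Submodule F V) :
    levelCount f a W = ({x | f x = a} ∩ (W : Set V)).ncard := by
  classical
  rw [levelCount, ← Set.ncard_coe_finset]
  congr 1
  ext x
  simp [and_comm]

end Code

theorem theorem1 {F K : Type*} [Field F] [Finite F] [Field K] [Finite K] [Algebra F K]
    (q m : ℕ) (hq : Nat.card F = q) (hq2 : ∃ e : ℕ, q = 2 ^ e)
    (hm : Module.finrank F K = m) (hme : Even m)
    (f : QuadraticForm F K) (hf : f.radical = ⊥) (hfI : IsEquivalentToTypeI f)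
    (a : F) (ha : a ≠ 0) (D : Set K) (hD : D = {x : K | f x = a})
    (n : ℤ) (hn : n = (q : ℤ) ^ (m - 1) - (q : ℤ) ^ ((m - 2) / 2)) :
    (D.ncard : ℤ) = n ∧
    (¬ (q = 2 ∧ m = 2) →
      Module.finrank F (definingSetCode F D) = m ∧
      (generalizedHammingWeight (definingSetCode F D) 1 : ℤ) = n - (q : ℤ) ^ (m - 2) ∧
      (∀ r : ℕ, 2 ≤ r → r ≤ m / 2 →
        (generalizedHammingWeight (definingSetCode F D) r : ℤ) =
          n - (q : ℤ) ^ (m - r - 1) - (q : ℤ) ^ ((m - 4) / 2)) ∧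
      (∀ r : ℕ, m / 2 < r → r < m - 1 →
        (generalizedHammingWeight (definingSetCode F D) r : ℤ) =
          n - (q : ℤ) ^ (m - r - 1) - (q : ℤ) ^ (m - r - 2)) ∧
      (generalizedHammingWeight (definingSetCode F D) (m - 1) : ℤ) = n - 1 ∧
      (generalizedHammingWeight (definingSetCode F D) m : ℤ) = n) := by
  have := Fintype.ofFinite F
  have := Fintype.ofFinite K
  rw [Nat.card_eq_fintype_card] at hq
  obtain ⟨e, he⟩ := hq2
  have : CharP F 2 := charP_of_card_eq_prime_pow (hq.trans he)
  obtain ⟨k, φ, hφ⟩ := hfI.exists_linearEquiv hf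
  obtain rfl : m = 2 * k := hm ▸ finrank_of_linearEquiv_prod φ
  have hk : 0 < k := by
    have := Module.finrank_pos (R := F) (M := K)
    omega
  have hq1 : 1 < q := hq ▸ Fintype.one_lt_card
  have hlen : (D.ncard : ℤ) = n := by
    have h1 := levelCount_top_of_hyperbolic φ hφ hk ha
    rw [levelCount_eq_ncard, Submodule.top_coe, Set.inter_univ, ← hD, hq] at h1
    rw [h1, hn, show (2 * k - 2) / 2 = k - 1 by omega]
  refine ⟨hlen, fun hne => ?_⟩
  have hcount : ∀ W : Submodule F K, levelCount f a W = (D ∩ W).ncard := fun W => by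
    rw [levelCount_eq_ncard, hD]
  have hhyp := isGreatest_levelCount_hyperplane φ hφ hk ha
  -- With `j = k - 1` this amounts to `1 < (q - 1) * q^j`, which fails only in the excluded case `q
  -- = 2`, `j = 0`.
  have hpow : q ^ (2 * k - 2) < D.ncard := by
    zify
    rw [hlen, hn, show (2 * k - 2) / 2 = k - 1 by omega]
    obtain ⟨j, rfl⟩ : ∃ j, k = j + 1 := ⟨k - 1, by omega⟩
    rw [show 2 * (j + 1) - 2 = j + j by omega, show 2 * (j + 1) - 1 = j + j + 1 by omega,
      Nat.add_sub_cancel, pow_succ, pow_add]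
    have hj : (1 : ℤ) ≤ q ^ j := one_le_pow₀ (by omega)
    rcases Nat.eq_zero_or_pos j with rfl | hj0
    · have : 3 ≤ q := by omega
      simp
      omega
    · have : (1 : ℤ) < q ^ j := one_lt_pow₀ (by omega) hj0.ne'
      have : (2 : ℤ) ≤ q := by omega
      nlinarith
  have hinj : Function.Injective (definingSetEncode F D) := by
    refine definingSetEncode_injective fun W hW => ?_
    rw [hm] at hW
    rw [← hcount]
    refine lt_of_le_of_lt (hhyp.2 ⟨W, hW, rfl⟩) ?_
    rwa [hq]
  have key : ∀ {r s M : ℕ}, r + s = 2 * k →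
      IsGreatest {N | ∃ W : Submodule F K, Module.finrank F W = s ∧ levelCount f a W = N} M →
      (generalizedHammingWeight (definingSetCode F D) r : ℤ) = n - M := by
    intro r s M hr hM
    simp only [hcount] at hM
    rw [generalizedHammingWeight_definingSetCode hinj (hr.trans hm.symm) hM, hlen]
  refine ⟨?_, ?_, ?_, ?_, ?_, ?_⟩
  · exact (LinearMap.finrank_range_of_inj hinj).trans hm
  · rw [key (by omega) hhyp, hq]
    push_cast
    rfl
  · intro r hr2 hrk
    rw [key (s := 2 * k - r) (by omega)
      (isGreatest_levelCount_of_ge φ hφ (by omega) (by omega) ha), hq,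
      show (2 * k - 4) / 2 = k - 2 by omega]
    push_cast
    ring
  · intro r hr hrm
    rw [key (s := 2 * k - r) (by omega)
      (isGreatest_levelCount_of_le φ hφ (by omega) (by omega) ha), hq]
    push_cast
    ring
  · rw [key (s := 1) (by omega) (isGreatest_levelCount_one φ hφ hk ha), Nat.cast_one]
  · rw [key (s := 0) (by omega) (isGreatest_levelCount_zero f ha), Nat.cast_zero, sub_zero]
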